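/- Let $n\ge 2$ be an integer and let $P_1,\dots,P_n$ be distinct real points of the projective plane $\mathbb{P}^2$ over $\mathbb{R}$. Then there is a birational map $f$ of $\mathbb{P}^2$ into itself, defined over $\mathbb{R}$ and defined at all real points, whose restriction to $\mathbb{P}^2(\mathbb{R})$ is an algebraic diffeomorphism (a bijection of $\mathbb{P}^2(\mathbb{R})$ onto itself which, like its inverse, is given in affine coordinates on an affine open subset of $\mathbb{P}^2$ containing $\mathbb{P}^2(\mathbb{R})$ by quotients of real polynomials whose denominators have no zero on $\mathbb{P}^2(\mathbb{R})$), such that none of the points $f(P_3),\dots,f(P_n)$ lies on the real projective line through $f(P_1)$ and $f(P_2)$. Moreover, $f$ can be chosen of the form $f=g\circ\alpha$ with $\alpha\in\mathrm{PGL}_3(\mathbb{R})$ and $g$ a real quintic Cremona transformation of the following kind. There are six distinct nonreal points $Q_1,\dots,Q_6\in\mathbb{P}^2(\mathbb{C})$, forming a set that is closed under complex conjugation, not all lying on a complex conic, and such that any complex conic through five of them is nonsingular; the map $g$ is birational over $\mathbb{R}$ and given by three real forms of degree $5$ without common factor, whose common zeros in $\mathbb{P}^2(\mathbb{C})$ are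 exactly $Q_1,\dots,Q_6$ and all of whose first partial derivatives vanish at $Q_1,\dots,Q_6$; and there are distinct points $R_1,\dots,R_6\in\mathbb{P}^2(\mathbb{C})$ such that, for each $i$, $g$ contracts the conic through the five points $Q_j$, $j\neq i$, to the point $R_i$. -/

import Mathlib

open MvPolynomial
open scoped LinearAlgebra.Projectivization

/-- The set of real points of the projective plane. -/
abbrev RealPlane : Type := ℙ ℝ (Fin 3 → ℝ)

/-- The set of complex points of the projective plane. -/
abbrev ComplexPlane : Type := ℙ ℂ (Fin 3 → ℂ)

/-! ### Rational and birational self-maps of the real projective plane -/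

/-- A rational self-map of the projective plane over `ℝ`, in its reduced homogeneous
representation `[x₀ : x₁ : x₂] ↦ [F₀(x) : F₁(x) : F₂(x)]`: three real ternary forms of the same
degree without common factor. Since the forms are coprime, the map is defined at a (real or
complex) point exactly if the three forms do not all vanish there, and the common degree of the
forms is the degree of the map. -/
structure RationalSelfMap where
  degree : ℕ
  form : Fin 3 → MvPolynomial (Fin 3) ℝ
  homogeneous : ∀ i, (form i).IsHomogeneous degree
  primitive : ∀ h : MvPolynomial (Fin 3) ℝ, (∀ i, h ∣ form i) → IsUnit h

/-- The triple of polynomials `G ∘ F` obtained by substituting the triple `F` into `G`. -/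
noncomputable def compForms (G F : Fin 3 → MvPolynomial (Fin 3) ℝ) :
    Fin 3 → MvPolynomial (Fin 3) ℝ :=
  fun i => bind₁ F (G i)

/-- Two nonzero triples of forms represent the same rational map to the projective plane. -/
def SameRationalMap (F G : Fin 3 → MvPolynomial (Fin 3) ℝ) : Prop :=
  ∀ i j, F i * G j = F j * G i

/-- The triple `F` represents the identity of the projective plane: it is
`(Φ x₀, Φ x₁, Φ x₂)` for a nonzero polynomial `Φ`. -/
def RepresentsIdentity (F : Fin 3 → MvPolynomial (Fin 3) ℝ) : Prop :=
  ∃ Φ : MvPolynomial (Fin 3) ℝ, Φ ≠ 0 ∧ ∀ i, F i = Φ * X i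

/-- A rational self-map of the projective plane is birational (a real Cremona transformation) if
it has a rational inverse. -/
def RationalSelfMap.IsBirational (f : RationalSelfMap) : Prop :=
  ∃ g : RationalSelfMap,
    RepresentsIdentity (compForms g.form f.form) ∧ RepresentsIdentity (compForms f.form g.form)

/-- The rational map `f` is defined at all real points, and its restriction to the real points
is the map `φ`. -/
def RationalSelfMap.RestrictsTo (f : RationalSelfMap) (φ : RealPlane → RealPlane) : Prop :=
  ∀ (v : Fin 3 → ℝ) (hv : v ≠ 0), ∃ hw : (fun i => eval v (f.form i)) ≠ 0,
    φ (Projectivization.mk ℝ v hv) = Projectivization.mk ℝ (fun i => eval v (f.form i)) hw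

/-- The triple of linear forms `A x` of a matrix `A`. -/
noncomputable def linearForms (A : Matrix (Fin 3) (Fin 3) ℝ) : Fin 3 → MvPolynomial (Fin 3) ℝ :=
  fun i => ∑ j, C (A i j) * X j

/-! ### Algebraic diffeomorphisms of the real points -/

/-- The coordinates of a real point under the closed embedding
`[x] ↦ (xᵢ xⱼ / (x₀² + x₁² + x₂²))ᵢⱼ` into `𝔸⁹` of the affine open subset
`x₀² + x₁² + x₂² ≠ 0` of the projective plane, which contains all real points. -/
noncomputable def affineCoord (p : RealPlane) : Fin 3 × Fin 3 → ℝ :=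
  fun ij => p.rep ij.1 * p.rep ij.2 / ∑ k, p.rep k ^ 2

theorem affineCoord_mk (v : Fin 3 → ℝ) (hv : v ≠ 0) (ij : Fin 3 × Fin 3) :
    affineCoord (Projectivization.mk ℝ v hv) ij = v ij.1 * v ij.2 / ∑ k, v k ^ 2 := by
  obtain ⟨a, ha⟩ := Projectivization.exists_smul_eq_mk_rep ℝ v hv
  have ha0 : (a : ℝ) ≠ 0 := a.ne_zero
  unfold affineCoord
  rw [← ha]
  have h1 : ∑ k, ((a • v) k) ^ 2 = (a : ℝ) ^ 2 * ∑ k, v k ^ 2 := by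
    rw [Finset.mul_sum]
    refine Finset.sum_congr rfl fun k _ => ?_
    simp only [Pi.smul_apply, Units.smul_def, smul_eq_mul]
    ring
  rw [h1]
  simp only [Pi.smul_apply, Units.smul_def, smul_eq_mul]
  rw [show (a : ℝ) * v ij.1 * (a * v ij.2) = (a : ℝ) ^ 2 * (v ij.1 * v ij.2) by ring]
  exact mul_div_mul_left _ _ (pow_ne_zero 2 ha0)

/-- A self-map of the real points of the projective plane is algebraic (regular) if, in the
affine coordinates above, it is given by quotients of real polynomials whose denominators vanish
at no real point. -/
def IsAlgebraicSelfMap (φ : RealPlane → RealPlane) : Prop :=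
  ∃ p q : Fin 3 × Fin 3 → MvPolynomial (Fin 3 × Fin 3) ℝ,
    (∀ ij x, eval (affineCoord x) (q ij) ≠ 0) ∧
    ∀ ij x, affineCoord (φ x) ij = eval (affineCoord x) (p ij) / eval (affineCoord x) (q ij)

/-- An algebraic diffeomorphism of the real points of the projective plane: an algebraic bijection
with algebraic inverse. -/
def IsAlgebraicDiffeomorphism (φ : RealPlane → RealPlane) : Prop :=
  IsAlgebraicSelfMap φ ∧
    ∃ ψ : RealPlane → RealPlane, Function.LeftInverse ψ φ ∧ Function.RightInverse ψ φ ∧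
      IsAlgebraicSelfMap ψ

/-- The point `r` lies on the real projective line through the (distinct) points `p` and `q`. -/
def OnLineThrough (p q r : RealPlane) : Prop :=
  r.submodule ≤ p.submodule ⊔ q.submodule

/-! ### Quintic Cremona transformations with six nonreal base points -/

/-- Complex conjugation on the complex points of the projective plane. -/
noncomputable def conjPoint (p : ComplexPlane) : ComplexPlane :=
  Projectivization.map (starLinearEquiv ℂ : (Fin 3 → ℂ) ≃ₗ⋆[ℂ] (Fin 3 → ℂ)).toLinearMap
    (starLinearEquiv ℂ).injective p

/-- The polynomial `F` vanishes at the point `p` (for all homogeneous coordinate vectors). -/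
def VanishesAt (F : MvPolynomial (Fin 3) ℂ) (p : ComplexPlane) : Prop :=
  ∀ v ∈ p.submodule, v ≠ 0 → eval v F = 0

/-- `F` is an equation of a complex conic. -/
def IsConic (F : MvPolynomial (Fin 3) ℂ) : Prop :=
  F.IsHomogeneous 2 ∧ F ≠ 0

/-- The plane curve with equation `F` is nonsingular: no point of it is a common zero of the three
partial derivatives of `F`. -/
def IsNonsingularCurve (F : MvPolynomial (Fin 3) ℂ) : Prop :=
  ∀ p : ComplexPlane, VanishesAt F p → ¬ ∀ k, VanishesAt (pderiv k F) p

/-- Six distinct nonreal points of the projective plane, closed under complex conjugation, not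
lying on a conic, and such that the conic through any five of them is nonsingular. -/
structure IsAdmissibleSextuple (Q : Fin 6 → ComplexPlane) : Prop where
  injective : Function.Injective Q
  nonreal : ∀ i, conjPoint (Q i) ≠ Q i
  conj_closed : ∀ i, ∃ j, Q j = conjPoint (Q i)
  not_on_conic : ∀ F, IsConic F → ¬ ∀ i, VanishesAt F (Q i)
  nonsingular : ∀ i F, IsConic F → (∀ j, j ≠ i → VanishesAt F (Q j)) → IsNonsingularCurve F

/-- The forms defining a rational map, regarded as complex forms. -/
noncomputable def RationalSelfMap.complexForm (f : RationalSelfMap) (k : Fin 3) :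
    MvPolynomial (Fin 3) ℂ :=
  map (algebraMap ℝ ℂ) (f.form k)

/-- `f` is a quintic Cremona transformation whose base points are the six nonreal points `Q i`,
given by quintic forms that are singular at each of the `Q i`. It contracts, for each `i`, the
conic through the five points `Q j`, `j ≠ i`, to a point `R i`, and these points are distinct. -/
structure IsQuinticCremona (Q : Fin 6 → ComplexPlane) (f : RationalSelfMap) : Prop where
  birational : f.IsBirational
  quintic : f.degree = 5
  admissible : IsAdmissibleSextuple Q
  base_points : ∀ p : ComplexPlane, (∀ k, VanishesAt (f.complexForm k) p) ↔ ∃ i, p = Q i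
  double : ∀ i k l, VanishesAt (pderiv l (f.complexForm k)) (Q i)
  contracts : ∃ R : Fin 6 → ComplexPlane, Function.Injective R ∧
    ∀ i F, IsConic F → (∀ j, j ≠ i → VanishesAt F (Q j)) →
      ∀ (v : Fin 3 → ℂ), eval v F = 0 →
        ∀ hw : (fun k => eval v (f.complexForm k)) ≠ 0, Projectivization.mk ℂ _ hw = R i

/-! ### Forms -/

/-! One fixed quintic Cremona map g serves for all point sets; only the linear map A in f = g ∘ A
depends on the points.

Put L(x,y,z) = 4x² + y² + 16z² and q(x,y,z) = 4L(x,y,z)² + 63²y²z², and let g = [x q(x,y,z) : y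
q(y,z,x) : z q(z,x,y)]. Over ℂ, q splits as (2L + 63i yz)(2L − 63i yz), so the three quartics give
six conics in conjugate pairs. At real nonzero vectors q is positive, hence g is defined at every
real point. If s exchanges the last two coordinates, then g ∘ s ∘ g is s times a nonzero form
(`quinticVec_swap_quinticVec`), so s ∘ g ∘ s is the inverse of g. It is again defined at every real
point, and g restricts to an algebraic diffeomorphism.

That g is of the required kind is explicit computation: the base points are found by elimination
(`quinticVec_eq_zero`), the conic through five of them is unique up to a scalar
(`eq_C_mul_conicForm`), and on it the coordinates of g are proportional to a constant vector
(`quinticVec_of_contractedConic`).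

For general position, f(P₁), f(P₂), f(Pᵢ) can be collinear only if a certain determinant vanishes.
This determinant is a polynomial in the entries of A (`quinticDet`). It is not identically zero,
because g sends some collinear triple to a noncollinear one
(`exists_matrix_det_quinticVec_ne_zero`). The product of these finitely many polynomials with det A
is a nonzero polynomial over an infinite field, so it is nonzero at some real A. -/

theorem MvPolynomial.IsHomogeneous.eval_smul_vector {σ R : Type*} [CommSemiring R]
    {F : MvPolynomial σ R} {n : ℕ} (hF : F.IsHomogeneous n) (c : R) (v : σ → R) :
    eval (c • v) F = c ^ n * eval v F := by
  rw [eval_eq, eval_eq, Finset.mul_sum]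
  refine Finset.sum_congr rfl fun d hd => ?_
  simp only [Pi.smul_apply, smul_eq_mul, mul_pow, Finset.prod_mul_distrib,
    Finset.prod_pow_eq_pow_sum]
  rw [hF.degree_eq_sum_deg_support hd]
  ring

/-- The self-map of coordinate vectors defined by a triple of polynomials. -/
noncomputable def evalForms (F : Fin 3 → MvPolynomial (Fin 3) ℝ) (v : Fin 3 → ℝ) : Fin 3 → ℝ :=
  fun i => eval v (F i)

theorem eval_bind₁_forms (F : Fin 3 → MvPolynomial (Fin 3) ℝ) (H : MvPolynomial (Fin 3) ℝ)
    (v : Fin 3 → ℝ) : eval v (bind₁ F H) = eval (evalForms F v) H := by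
  simp only [eval, eval₂Hom_bind₁]
  rfl

theorem evalForms_compForms (G F : Fin 3 → MvPolynomial (Fin 3) ℝ) (v : Fin 3 → ℝ) :
    evalForms (compForms G F) v = evalForms G (evalForms F v) :=
  funext fun i => eval_bind₁_forms F (G i) v

theorem evalForms_linearForms (A : Matrix (Fin 3) (Fin 3) ℝ) (v : Fin 3 → ℝ) :
    evalForms (linearForms A) v = A.mulVec v := by
  ext i
  simp [evalForms, linearForms, Matrix.mulVec, dotProduct]

theorem evalForms_smul {F : Fin 3 → MvPolynomial (Fin 3) ℝ} {d : ℕ}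
    (hF : ∀ i, (F i).IsHomogeneous d) (c : ℝ) (v : Fin 3 → ℝ) :
    evalForms F (c • v) = c ^ d • evalForms F v :=
  funext fun i => (hF i).eval_smul_vector c v

theorem compForms_assoc (H G F : Fin 3 → MvPolynomial (Fin 3) ℝ) :
    compForms (compForms H G) F = compForms H (compForms G F) := by
  ext1 i
  exact bind₁_bind₁ G F (H i)

theorem compForms_X (F : Fin 3 → MvPolynomial (Fin 3) ℝ) : compForms F X = F := by
  ext1 i
  simp [compForms]

theorem X_compForms (F : Fin 3 → MvPolynomial (Fin 3) ℝ) : compForms X F = F := by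
  ext1 i
  simp [compForms]

theorem linearForms_one : linearForms 1 = X := by
  ext1 i
  simp [linearForms, Matrix.one_apply]

theorem compForms_linearForms_mul (A B : Matrix (Fin 3) (Fin 3) ℝ) :
    compForms (linearForms A) (linearForms B) = linearForms (A * B) := by
  ext1 i
  simp only [compForms, linearForms, map_sum, map_mul, bind₁_C_right, bind₁_X_right,
    Matrix.mul_apply, Finset.mul_sum, Finset.sum_mul]
  rw [Finset.sum_comm]
  refine Finset.sum_congr rfl fun j _ => Finset.sum_congr rfl fun k _ => by ring

theorem linearForms_isHomogeneous (A : Matrix (Fin 3) (Fin 3) ℝ) (i : Fin 3) :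
    (linearForms A i).IsHomogeneous 1 :=
  IsHomogeneous.sum _ _ _ fun j _ => isHomogeneous_C_mul_X _ j

theorem compForms_isHomogeneous {G F : Fin 3 → MvPolynomial (Fin 3) ℝ} {d e : ℕ}
    (hG : ∀ i, (G i).IsHomogeneous d) (hF : ∀ i, (F i).IsHomogeneous e) (i : Fin 3) :
    (compForms G F i).IsHomogeneous (e * d) :=
  (hG i).aeval F hF

theorem linearForms_mul_inv (A : GL (Fin 3) ℝ) :
    compForms (linearForms A.val) (linearForms (A⁻¹).val) = X := by
  rw [compForms_linearForms_mul, ← Units.val_mul, mul_inv_cancel, Units.val_one, linearForms_one]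

theorem linearForms_inv_mul (A : GL (Fin 3) ℝ) :
    compForms (linearForms (A⁻¹).val) (linearForms A.val) = X := by
  rw [compForms_linearForms_mul, ← Units.val_mul, inv_mul_cancel, Units.val_one, linearForms_one]

theorem isUnit_bind₁ (F : Fin 3 → MvPolynomial (Fin 3) ℝ) {h : MvPolynomial (Fin 3) ℝ}
    (hh : IsUnit h) : IsUnit (bind₁ F h) :=
  hh.map (bind₁ F)

/-! ### Composition with projective transformations -/

/-- The rational map `f ∘ A`. -/
noncomputable def RationalSelfMap.precomp (f : RationalSelfMap) (A : GL (Fin 3) ℝ) :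
    RationalSelfMap where
  degree := f.degree
  form := compForms f.form (linearForms A.val)
  homogeneous i := by
    simpa using compForms_isHomogeneous f.homogeneous (linearForms_isHomogeneous A.val) i
  primitive h hh := by
    -- A common factor of the forms of f ∘ A, pulled back along the inverse of A, is a common factor
    -- of the forms of f.
    have key : IsUnit (bind₁ (linearForms (A⁻¹).val) h) := by
      refine f.primitive _ fun i => ?_
      have := map_dvd (bind₁ (linearForms (A⁻¹).val)) (hh i)
      rwa [← compForms, compForms_assoc, linearForms_mul_inv, compForms_X] at this
    have := isUnit_bind₁ (linearForms A.val) key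
    rw [bind₁_bind₁] at this
    change IsUnit (bind₁ (compForms (linearForms (A⁻¹).val) (linearForms A.val)) h) at this
    rw [linearForms_inv_mul] at this
    simpa using this

/-- The rational map `A ∘ f`. -/
noncomputable def RationalSelfMap.postcomp (A : GL (Fin 3) ℝ) (f : RationalSelfMap) :
    RationalSelfMap where
  degree := f.degree
  form := compForms (linearForms A.val) f.form
  homogeneous i := by
    simpa using compForms_isHomogeneous (linearForms_isHomogeneous A.val) f.homogeneous i
  primitive h hh := by
    refine f.primitive h fun i => ?_
    have : f.form = compForms (linearForms (A⁻¹).val) (compForms (linearForms A.val) f.form) := by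
      rw [← compForms_assoc, linearForms_inv_mul, X_compForms]
    rw [this]
    simp only [compForms, linearForms, map_sum, map_mul, bind₁_C_right, bind₁_X_right]
    refine Finset.dvd_sum fun j _ => Dvd.dvd.mul_left ?_ _
    simpa [compForms, linearForms] using hh j

/-- If F is Φ times the identity, its conjugate by A is (Φ ∘ A) times the identity; Φ ∘ A is nonzero
because substituting A is invertible. -/
theorem RepresentsIdentity.conj {F : Fin 3 → MvPolynomial (Fin 3) ℝ} (hF : RepresentsIdentity F)
    (A : GL (Fin 3) ℝ) :
    RepresentsIdentity
      (compForms (linearForms (A⁻¹).val) (compForms F (linearForms A.val))) := by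
  obtain ⟨Φ, hΦ, h⟩ := hF
  refine ⟨bind₁ (linearForms A.val) Φ, fun h0 => hΦ ?_, fun i => ?_⟩
  · have := congrArg (bind₁ (linearForms (A⁻¹).val)) h0
    rw [bind₁_bind₁] at this
    change bind₁ (compForms (linearForms A.val) (linearForms (A⁻¹).val)) Φ = _ at this
    rw [linearForms_mul_inv] at this
    simpa using this
  · have h1 := congrFun (linearForms_inv_mul A) i
    rw [← h1]
    simp only [compForms, linearForms, map_sum, map_mul, bind₁_C_right, bind₁_X_right, h,
      Finset.mul_sum]
    exact Finset.sum_congr rfl fun j _ => Finset.sum_congr rfl fun k _ => by ring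

/-- The rational maps `f` and `g` are inverse to each other. -/
def RationalSelfMap.AreInverse (f g : RationalSelfMap) : Prop :=
  RepresentsIdentity (compForms g.form f.form) ∧ RepresentsIdentity (compForms f.form g.form)

theorem RationalSelfMap.AreInverse.precomp {f g : RationalSelfMap} (h : f.AreInverse g)
    (A : GL (Fin 3) ℝ) : (f.precomp A).AreInverse (g.postcomp A⁻¹) := by
  refine ⟨?_, ?_⟩
  · have := h.1.conj A
    rw [compForms_assoc] at this
    simpa only [RationalSelfMap.precomp, RationalSelfMap.postcomp, compForms_assoc] using this
  · have : compForms (f.precomp A).form (g.postcomp A⁻¹).form = compForms f.form g.form := by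
      simp only [RationalSelfMap.precomp, RationalSelfMap.postcomp]
      rw [compForms_assoc, ← compForms_assoc (linearForms A.val), linearForms_mul_inv, X_compForms]
    rw [this]
    exact h.2

/-! ### Rational maps defined at all real points -/

/-- The forms of `f` have no common real zero. -/
def RationalSelfMap.IsRegular (f : RationalSelfMap) : Prop :=
  ∀ v : Fin 3 → ℝ, v ≠ 0 → evalForms f.form v ≠ 0

theorem mulVec_ne_zero (A : GL (Fin 3) ℝ) {v : Fin 3 → ℝ} (hv : v ≠ 0) :
    A.val.mulVec v ≠ 0 := by
  intro h
  apply hv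
  have := congrArg (A⁻¹).val.mulVec h
  rwa [Matrix.mulVec_mulVec, ← Units.val_mul, inv_mul_cancel, Units.val_one, Matrix.one_mulVec,
    Matrix.mulVec_zero] at this

theorem RationalSelfMap.IsRegular.precomp {f : RationalSelfMap} (hf : f.IsRegular)
    (A : GL (Fin 3) ℝ) : (f.precomp A).IsRegular := by
  intro v hv
  change evalForms (compForms f.form (linearForms A.val)) v ≠ 0
  rw [evalForms_compForms, evalForms_linearForms]
  exact hf _ (mulVec_ne_zero A hv)

theorem RationalSelfMap.IsRegular.postcomp {f : RationalSelfMap} (hf : f.IsRegular)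
    (A : GL (Fin 3) ℝ) : (f.postcomp A).IsRegular := by
  intro v hv
  change evalForms (compForms (linearForms A.val) f.form) v ≠ 0
  rw [evalForms_compForms, evalForms_linearForms]
  exact mulVec_ne_zero A (hf v hv)

/-- The restriction to the real points of a rational map that is defined at all of them. -/
noncomputable def RationalSelfMap.realMap (f : RationalSelfMap) (hf : f.IsRegular) :
    RealPlane → RealPlane :=
  fun p => Projectivization.mk ℝ (evalForms f.form p.rep) (hf _ p.rep_nonzero)

theorem RationalSelfMap.realMap_mk (f : RationalSelfMap) (hf : f.IsRegular) (v : Fin 3 → ℝ)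
    (hv : v ≠ 0) : f.realMap hf (Projectivization.mk ℝ v hv) =
      Projectivization.mk ℝ (evalForms f.form v) (hf v hv) := by
  obtain ⟨a, ha⟩ := Projectivization.exists_smul_eq_mk_rep ℝ v hv
  rw [RationalSelfMap.realMap, Projectivization.mk_eq_mk_iff']
  refine ⟨(a : ℝ) ^ f.degree, ?_⟩
  rw [← ha, Units.smul_def, evalForms_smul f.homogeneous]

theorem RationalSelfMap.restrictsTo_realMap (f : RationalSelfMap) (hf : f.IsRegular) :
    f.RestrictsTo (f.realMap hf) :=
  fun v hv => ⟨hf v hv, f.realMap_mk hf v hv⟩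

theorem sum_sq_pos {v : Fin 3 → ℝ} (hv : v ≠ 0) : 0 < ∑ k, v k ^ 2 := by
  obtain ⟨k, hk⟩ := Function.ne_iff.mp hv
  exact Finset.sum_pos' (fun i _ => sq_nonneg _) ⟨k, Finset.mem_univ k, sq_pos_of_ne_zero hk⟩

theorem RationalSelfMap.realMap_isAlgebraic (f : RationalSelfMap) (hf : f.IsRegular) :
    IsAlgebraicSelfMap (f.realMap hf) := by
  -- The k-th row of the matrix (xᵢxⱼ/|x|²) is x scaled by xₖ/|x|², so `s k i` evaluates to
  -- (xₖ/|x|²)^d times the i-th form at x. This scalar vanishes when xₖ = 0 and d > 0; summing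
  -- products over all k replaces it by a sum of squares that is positive everywhere. It cancels on
  -- division by the trace of `p`.
  let s : Fin 3 → Fin 3 → MvPolynomial (Fin 3 × Fin 3) ℝ :=
    fun k i => rename (fun j => (k, j)) (f.form i)
  let p : Fin 3 × Fin 3 → MvPolynomial (Fin 3 × Fin 3) ℝ := fun ij => ∑ k, s k ij.1 * s k ij.2
  have hp : ∀ (v : Fin 3 → ℝ) (hv : v ≠ 0) (ij : Fin 3 × Fin 3),
      eval (affineCoord (Projectivization.mk ℝ v hv)) (p ij) =
        (∑ k, ((v k / ∑ l, v l ^ 2) ^ f.degree) ^ 2) *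
          (evalForms f.form v ij.1 * evalForms f.form v ij.2) := by
    intro v hv ij
    have hs : ∀ k i, eval (affineCoord (Projectivization.mk ℝ v hv)) (s k i) =
        (v k / ∑ l, v l ^ 2) ^ f.degree * evalForms f.form v i := by
      intro k i
      rw [eval_rename, evalForms, ← (f.homogeneous i).eval_smul_vector]
      congr 2
      ext j
      simp only [Function.comp_apply, affineCoord_mk, Pi.smul_apply, smul_eq_mul]
      ring
    simp only [p, map_sum, map_mul, hs, Finset.sum_mul]
    exact Finset.sum_congr rfl fun k _ => by ring
  have hpos : ∀ v : Fin 3 → ℝ, v ≠ 0 → 0 < ∑ k, ((v k / ∑ l, v l ^ 2) ^ f.degree) ^ 2 := by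
    intro v hv
    obtain ⟨k, hk⟩ := Function.ne_iff.mp hv
    have hk' : v k ≠ 0 := hk
    have := (sum_sq_pos hv).ne'
    exact Finset.sum_pos' (fun i _ => sq_nonneg _) ⟨k, Finset.mem_univ k, by positivity⟩
  have hq : ∀ (v : Fin 3 → ℝ) (hv : v ≠ 0),
      eval (affineCoord (Projectivization.mk ℝ v hv)) (∑ l, p (l, l)) =
        (∑ k, ((v k / ∑ l, v l ^ 2) ^ f.degree) ^ 2) * ∑ l, evalForms f.form v l ^ 2 := by
    intro v hv
    simp only [map_sum, hp, Finset.mul_sum, sq]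
  refine ⟨p, fun _ => ∑ l, p (l, l), fun _ x => ?_, fun ij x => ?_⟩
  · induction x using Projectivization.ind with
    | h v hv =>
      rw [hq]
      exact (mul_pos (hpos v hv) (sum_sq_pos (hf v hv))).ne'
  · induction x using Projectivization.ind with
    | h v hv =>
      rw [hq, hp, f.realMap_mk, affineCoord_mk, mul_div_mul_left _ _ (hpos v hv).ne']

theorem RationalSelfMap.realMap_leftInverse {f g : RationalSelfMap} (hf : f.IsRegular)
    (hg : g.IsRegular) (h : RepresentsIdentity (compForms g.form f.form)) :
    Function.LeftInverse (g.realMap hg) (f.realMap hf) := by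
  obtain ⟨Φ, -, hΦ⟩ := h
  intro p
  induction p using Projectivization.ind with
  | h v hv =>
    rw [f.realMap_mk, g.realMap_mk, Projectivization.mk_eq_mk_iff']
    refine ⟨eval v Φ, ?_⟩
    rw [← evalForms_compForms]
    ext i
    simp [evalForms, hΦ]

theorem RationalSelfMap.AreInverse.isAlgebraicDiffeomorphism {f g : RationalSelfMap}
    (h : f.AreInverse g) (hf : f.IsRegular) (hg : g.IsRegular) :
    IsAlgebraicDiffeomorphism (f.realMap hf) :=
  ⟨f.realMap_isAlgebraic hf, g.realMap hg, realMap_leftInverse hf hg h.1,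
    realMap_leftInverse hg hf h.2, g.realMap_isAlgebraic hg⟩

/-! ### An explicit quintic Cremona transformation -/

section Quintic

variable {R : Type*} [CommRing R]

/-- The quartic form that is the product of two conjugate conics contracted by the quintic map. -/
def conicPair (x y z : R) : R :=
  4 * (4 * x ^ 2 + y ^ 2 + 16 * z ^ 2) ^ 2 + 3969 * (y ^ 2 * z ^ 2)

/-- The quintic map in coordinates. -/
def quinticVec (v : Fin 3 → R) : Fin 3 → R :=
  ![v 0 * conicPair (v 0) (v 1) (v 2), v 1 * conicPair (v 1) (v 2) (v 0),
    v 2 * conicPair (v 2) (v 0) (v 1)]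

theorem map_quinticVec {S F : Type*} [CommRing S] [FunLike F R S] [RingHomClass F R S] (φ : F)
    (v : Fin 3 → R) (i : Fin 3) :
    φ (quinticVec v i) = quinticVec (fun j => φ (v j)) i := by
  have h (n : ℕ) [n.AtLeastTwo] : φ (OfNat.ofNat n) = OfNat.ofNat n := map_ofNat φ n
  fin_cases i <;> simp [quinticVec, conicPair, h]

/-- The left side pulls back under the quintic map a pair of conics contracted by its inverse. Only
contracted curves can map into such a pair, so the pullback of degree 20 is made of the three
quartics, here with multiplicities 1, 2, 2. -/
theorem conicPair_quintic (x y z : R) :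
    conicPair (x * conicPair x y z) (z * conicPair z x y) (y * conicPair y z x) =
      conicPair x y z * conicPair y z x ^ 2 * conicPair z x y ^ 2 := by
  simp only [conicPair]
  ring

theorem quinticVec_swap_quinticVec (v : Fin 3 → R) :
    quinticVec ![quinticVec v 0, quinticVec v 2, quinticVec v 1] =
      (conicPair (v 0) (v 1) (v 2) * conicPair (v 1) (v 2) (v 0) * conicPair (v 2) (v 0) (v 1)) ^ 2
        • ![v 0, v 2, v 1] := by
  have h0 := conicPair_quintic (v 0) (v 1) (v 2)
  have h1 := conicPair_quintic (v 1) (v 2) (v 0)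
  have h2 := conicPair_quintic (v 2) (v 0) (v 1)
  ext i
  fin_cases i
  · simp [quinticVec, h0]
    ring
  · simp [quinticVec, h2]
    ring
  · simp [quinticVec, h1]
    ring

/-- With L = 4x² + y² + 16z² and L' = 4y² + z² + 16x², this combination makes the quartic terms
factor as L L'. Moreover 4L − L' = 63z². The two identities together eliminate common factors in
`isUnit_of_dvd_quinticVec` and common zeros in `conicPair_ne_zero_of_ne_zero`. -/
theorem conicPair_add (x y z : R) :
    conicPair x y z + 4 * conicPair y z x =
      65 * ((4 * x ^ 2 + y ^ 2 + 16 * z ^ 2) * (4 * y ^ 2 + z ^ 2 + 16 * x ^ 2)) := by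
  simp only [conicPair]
  ring

end Quintic

theorem eval_quinticVec_X {R : Type*} [CommRing R] (v : Fin 3 → R) (i : Fin 3) :
    eval v (quinticVec X i) = quinticVec v i := by
  simp [map_quinticVec]

theorem quinticVec_X_isHomogeneous {R : Type*} [CommRing R] (i : Fin 3) :
    (quinticVec (X : Fin 3 → MvPolynomial (Fin 3) R) i).IsHomogeneous 5 := by
  have hsq (c : R) (j : Fin 3) : (C c * X j ^ 2 : MvPolynomial (Fin 3) R).IsHomogeneous 2 :=
    isHomogeneous_C_mul_X_pow c j 2
  have hp (j k l : Fin 3) :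
      (conicPair (X j) (X k) (X l) : MvPolynomial (Fin 3) R).IsHomogeneous 4 := by
    have : (conicPair (X j) (X k) (X l) : MvPolynomial (Fin 3) R) =
        C 4 * (C 4 * X j ^ 2 + C 1 * X k ^ 2 + C 16 * X l ^ 2) ^ 2
          + C 3969 * (X k ^ 2 * X l ^ 2) := by
      simp [conicPair, map_ofNat]
    rw [this]
    exact ((((hsq 4 j).add (hsq 1 k)).add (hsq 16 l)).pow 2 |>.C_mul 4).add
      (((isHomogeneous_X_pow k 2).mul (isHomogeneous_X_pow l 2)).C_mul 3969)
  fin_cases i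
  · exact (isHomogeneous_X R 0).mul (hp 0 1 2)
  · exact (isHomogeneous_X R 1).mul (hp 1 2 0)
  · exact (isHomogeneous_X R 2).mul (hp 2 0 1)

/-! ### Positivity at real points and coprimality of the forms -/

theorem conicPair_pos {v : Fin 3 → ℝ} (hv : v ≠ 0) (σ : Equiv.Perm (Fin 3)) :
    0 < conicPair (v (σ 0)) (v (σ 1)) (v (σ 2)) := by
  have h : ∃ i, v (σ i) ≠ 0 := by
    obtain ⟨k, hk⟩ := Function.ne_iff.mp hv
    exact ⟨σ.symm k, by simpa using hk⟩
  have : 0 < 4 * v (σ 0) ^ 2 + v (σ 1) ^ 2 + 16 * v (σ 2) ^ 2 := by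
    obtain ⟨i, hi⟩ := h
    fin_cases i <;> simp only [Fin.zero_eta, Fin.mk_one, Fin.reduceFinMk] at hi <;> positivity
  unfold conicPair
  positivity

theorem quinticVec_ne_zero {v : Fin 3 → ℝ} (hv : v ≠ 0) : quinticVec v ≠ 0 := by
  intro h
  apply hv
  have h0 : 0 < conicPair (v 0) (v 1) (v 2) := conicPair_pos hv 1
  have h1 : 0 < conicPair (v 1) (v 2) (v 0) := conicPair_pos hv (finRotate 3)
  have h2 : 0 < conicPair (v 2) (v 0) (v 1) := conicPair_pos hv (finRotate 3).symm
  have k0 := congrFun h 0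
  have k1 := congrFun h 1
  have k2 := congrFun h 2
  simp only [quinticVec, Matrix.cons_val, Pi.zero_apply, mul_eq_zero, h0.ne', h1.ne', h2.ne',
    or_false] at k0 k1 k2
  ext i
  fin_cases i
  exacts [k0, k1, k2]

/-- A common irreducible factor cannot be a coordinate, since the forms have no common real zero. It
therefore divides all three quartics, hence by `conicPair_add` two of the three cyclic quadrics, and
so the square of a coordinate. -/
theorem isUnit_of_dvd_quinticVec (h : MvPolynomial (Fin 3) ℝ)
    (hh : ∀ i, h ∣ quinticVec X i) : IsUnit h := by
  have hcoord : ∀ π : MvPolynomial (Fin 3) ℝ, Irreducible π → (∀ i, π ∣ quinticVec X i) →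
      ∀ j, ¬ π ∣ X j := by
    intro π hπ hd j hj
    have hX : X j ∣ π :=
      (hπ.associated_of_dvd (X_prime (i := j)).irreducible hj).symm.dvd
    -- A real nonzero vector on the line where the j-th coordinate vanishes; all three forms would
    -- vanish at it.
    let v : Fin 3 → ℝ := fun k => if k = j then 0 else 1
    refine quinticVec_ne_zero (v := v) ?_ ?_
    · refine Function.ne_iff.mpr ⟨j + 1, ?_⟩
      fin_cases j <;> simp [v]
    · ext i
      have := map_dvd (eval v) (hX.trans (hd i))
      rw [eval_quinticVec_X] at this
      simpa [v] using this
  by_contra hu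
  have h0 : h ≠ 0 := by
    rintro rfl
    have h1 : (fun _ => 1 : Fin 3 → ℝ) ≠ 0 := Function.ne_iff.mpr ⟨0, by simp⟩
    apply quinticVec_ne_zero h1
    ext i
    rw [← eval_quinticVec_X, zero_dvd_iff.mp (hh i)]
    simp
  obtain ⟨π, hπ, hπh⟩ := WfDvdMonoid.exists_irreducible_factor hu h0
  have hd := fun i => hπh.trans (hh i)
  have hX := hcoord π hπ hd
  have hp : Prime π := hπ.prime
  have hC : ∀ (c : ℝ) (a : MvPolynomial (Fin 3) ℝ), c ≠ 0 → π ∣ C c * a → π ∣ a := by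
    intro c a hc hca
    have := hca.mul_left (C c⁻¹)
    rwa [← mul_assoc, ← C_mul, inv_mul_cancel₀ hc, C_1, one_mul] at this
  have q0 : π ∣ conicPair (X 0) (X 1) (X 2) := (hp.dvd_or_dvd (hd 0)).resolve_left (hX 0)
  have q1 : π ∣ conicPair (X 1) (X 2) (X 0) := (hp.dvd_or_dvd (hd 1)).resolve_left (hX 1)
  have q2 : π ∣ conicPair (X 2) (X 0) (X 1) := (hp.dvd_or_dvd (hd 2)).resolve_left (hX 2)
  have hlin : ∀ i j k : Fin 3, π ∣ conicPair (X i) (X j) (X k) → π ∣ conicPair (X j) (X k) (X i) →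
      π ∣ 4 * X i ^ 2 + X j ^ 2 + 16 * X k ^ 2 ∨ π ∣ 4 * X j ^ 2 + X k ^ 2 + 16 * X i ^ 2 := by
    intro i j k h1 h2
    refine hp.dvd_or_dvd (hC 65 _ (by norm_num) ?_)
    rw [map_ofNat C 65, ← conicPair_add]
    exact dvd_add h1 (h2.mul_left 4)
  have hfin : ∀ i j k : Fin 3, π ∣ 4 * X i ^ 2 + X j ^ 2 + 16 * X k ^ 2 →
      ¬ π ∣ 4 * X j ^ 2 + X k ^ 2 + 16 * X i ^ 2 := by
    intro i j k h1 h2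
    refine hX k (hp.dvd_of_dvd_pow (hC 63 (X k ^ 2) (by norm_num) ?_))
    convert dvd_sub (h1.mul_left 4) h2 using 1
    rw [map_ofNat C 63]
    ring
  have l0 := hlin 0 1 2 q0 q1
  have l1 := hlin 1 2 0 q1 q2
  have l2 := hlin 2 0 1 q2 q0
  have f0 := hfin 0 1 2
  have f1 := hfin 1 2 0
  have f2 := hfin 2 0 1
  -- Each cyclically consecutive pair of quadrics contains one divisible by π, so at least two of
  -- the three are; any two are consecutive, which `hfin` excludes.
  rcases l0 with h0 | h0
  · exact l1.elim (f0 h0) fun h => f2 h h0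
  · exact l2.elim (f1 h0) fun h => f0 h h0

/-- The quintic Cremona transformation with base points `[1 : ±2i : 0]`, `[0 : 1 : ±2i]`,
`[±2i : 0 : 1]`. -/
noncomputable def quinticMap : RationalSelfMap where
  degree := 5
  form := quinticVec X
  homogeneous := quinticVec_X_isHomogeneous
  primitive := isUnit_of_dvd_quinticVec

theorem evalForms_quinticMap (v : Fin 3 → ℝ) : evalForms quinticMap.form v = quinticVec v :=
  funext (eval_quinticVec_X v)

theorem quinticMap_isRegular : quinticMap.IsRegular := by
  intro v hv
  rw [evalForms_quinticMap]
  exact quinticVec_ne_zero hv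

/-- The projective transformation exchanging the last two coordinates. -/
def swapMatrix : GL (Fin 3) ℝ where
  val := !![1, 0, 0; 0, 0, 1; 0, 1, 0]
  inv := !![1, 0, 0; 0, 0, 1; 0, 1, 0]
  val_inv := by ext i j; fin_cases i <;> fin_cases j <;> simp [Matrix.mul_apply, Fin.sum_univ_three]
  inv_val := by ext i j; fin_cases i <;> fin_cases j <;> simp [Matrix.mul_apply, Fin.sum_univ_three]

theorem linearForms_swapMatrix : linearForms swapMatrix.val = ![X 0, X 2, X 1] := by
  ext1 i
  fin_cases i <;> simp [linearForms, swapMatrix, Fin.sum_univ_three]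

/-- The inverse of the quintic Cremona transformation `quinticMap`. -/
noncomputable def quinticInverse : RationalSelfMap :=
  (quinticMap.precomp swapMatrix).postcomp swapMatrix

theorem quinticInverse_isRegular : quinticInverse.IsRegular :=
  (quinticMap_isRegular.precomp _).postcomp _

theorem compForms_swap (F : Fin 3 → MvPolynomial (Fin 3) ℝ) :
    compForms ![X 0, X 2, X 1] F = ![F 0, F 2, F 1] := by
  ext1 i
  fin_cases i <;> simp [compForms]

theorem compForms_quinticVec (F : Fin 3 → MvPolynomial (Fin 3) ℝ) :
    compForms (quinticVec X) F = quinticVec F := by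
  ext1 i
  simp [compForms, map_quinticVec]

theorem quinticMap_areInverse : quinticMap.AreInverse quinticInverse := by
  have hform : quinticInverse.form =
      compForms ![X 0, X 2, X 1] (compForms (quinticVec X) ![X 0, X 2, X 1]) := by
    rw [← linearForms_swapMatrix]
    rfl
  -- At the all-ones vector each quartic takes the value 4·21² + 3969 = 5733, so the scalar factor
  -- is not the zero polynomial.
  have hne : ∀ (v : Fin 3 → MvPolynomial (Fin 3) ℝ),
      (∀ i, eval (fun _ => 1) (v i) = 1) →
      (conicPair (v 0) (v 1) (v 2) * conicPair (v 1) (v 2) (v 0) *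
        conicPair (v 2) (v 0) (v 1)) ^ 2 ≠ 0 := by
    intro v hv h
    have := congrArg (eval fun _ => 1) h
    simp [conicPair, hv, map_ofNat] at this
    norm_num at this
  refine ⟨⟨_, hne X (by simp), fun i => ?_⟩, ⟨_, hne ![X 0, X 2, X 1] ?_, fun i => ?_⟩⟩
  · rw [hform]
    rw [show quinticMap.form = quinticVec X from rfl, compForms_assoc, compForms_assoc,
      compForms_swap, compForms_quinticVec, compForms_swap, quinticVec_swap_quinticVec]
    fin_cases i <;> simp only [Pi.smul_apply, smul_eq_mul, Matrix.cons_val, Fin.zero_eta,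
      Fin.mk_one, Fin.reduceFinMk]
  · intro i
    fin_cases i <;> simp
  · rw [hform]
    rw [show quinticMap.form = quinticVec X from rfl, compForms_quinticVec,
      compForms_quinticVec, compForms_swap, quinticVec_swap_quinticVec]
    fin_cases i <;> simp only [Pi.smul_apply, smul_eq_mul, Matrix.cons_val, Fin.zero_eta,
      Fin.mk_one, Fin.reduceFinMk]

/-! ### The base points and the contracted conics -/

theorem vanishesAt_mk {F : MvPolynomial (Fin 3) ℂ} {n : ℕ} (hF : F.IsHomogeneous n)
    (v : Fin 3 → ℂ) (hv : v ≠ 0) :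
    VanishesAt F (Projectivization.mk ℂ v hv) ↔ eval v F = 0 := by
  refine ⟨fun h => h v ?_ hv, fun h w hw _ => ?_⟩
  · rw [Projectivization.submodule_mk]
    exact Submodule.mem_span_singleton_self v
  · rw [Projectivization.submodule_mk] at hw
    obtain ⟨c, rfl⟩ := Submodule.mem_span_singleton.mp hw
    rw [hF.eval_smul_vector, h, mul_zero]

/-- Coordinate vectors of the six base points. -/
noncomputable def baseVec : Fin 6 → Fin 3 → ℂ :=
  ![![1, 2 * Complex.I, 0], ![1, -(2 * Complex.I), 0], ![0, 1, 2 * Complex.I],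
    ![0, 1, -(2 * Complex.I)], ![2 * Complex.I, 0, 1], ![-(2 * Complex.I), 0, 1]]

theorem baseVec_ne_zero (i : Fin 6) : baseVec i ≠ 0 := by
  intro h
  fin_cases i
  · simpa [baseVec] using congrFun h 0
  · simpa [baseVec] using congrFun h 0
  · simpa [baseVec] using congrFun h 1
  · simpa [baseVec] using congrFun h 1
  · simpa [baseVec] using congrFun h 2
  · simpa [baseVec] using congrFun h 2

/-- The six base points of the quintic Cremona transformation. -/
noncomputable def basePoint (i : Fin 6) : ComplexPlane :=
  Projectivization.mk ℂ (baseVec i) (baseVec_ne_zero i)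

theorem two_mul_I_ne : 2 * Complex.I ≠ -(2 * Complex.I) := by
  intro h
  have := congrArg Complex.im h
  norm_num at this

theorem basePoint_injective : Function.Injective basePoint := by
  have hI := two_mul_I_ne
  have hI' := hI.symm
  intro i j h
  obtain ⟨c, hc⟩ := (Projectivization.mk_eq_mk_iff' ℂ _ _ _ _).mp h
  have h0 := congrFun hc 0
  have h1 := congrFun hc 1
  have h2 := congrFun hc 2
  clear h hc
  fin_cases i <;> fin_cases j <;> simp [baseVec] at h0 h1 h2 ⊢ <;> simp_all

theorem conjPoint_mk (v : Fin 3 → ℂ) (hv : v ≠ 0) (hv' : star v ≠ 0) :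
    conjPoint (Projectivization.mk ℂ v hv) = Projectivization.mk ℂ (star v) hv' :=
  rfl

theorem conjPoint_basePoint (i : Fin 6) :
    conjPoint (basePoint i) = basePoint (![1, 0, 3, 2, 5, 4] i) := by
  have h : star (baseVec i) = baseVec (![1, 0, 3, 2, 5, 4] i) := by
    ext j
    fin_cases i <;> fin_cases j <;> simp [baseVec]
  have hne := baseVec_ne_zero (![1, 0, 3, 2, 5, 4] i)
  rw [← h] at hne
  rw [basePoint, conjPoint_mk _ _ hne, basePoint]
  simp only [h]

/-- Quadratic forms are sums of products of two linear forms, and the shape is stable under such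
sums. -/
theorem exists_coeff_of_isHomogeneous_two {F : MvPolynomial (Fin 3) ℂ} (hF : F.IsHomogeneous 2) :
    ∃ a b c d e f : ℂ, F = C a * X 0 ^ 2 + C b * X 1 ^ 2 + C c * X 2 ^ 2 + C d * (X 0 * X 1) +
      C e * (X 1 * X 2) + C f * (X 2 * X 0) := by
  have hmem : F ∈ (homogeneousSubmodule (Fin 3) ℂ 1) ^ 2 := by
    rw [homogeneousSubmodule_one_pow]
    exact hF
  rw [sq] at hmem
  clear hF
  have hlin : ∀ G ∈ homogeneousSubmodule (Fin 3) ℂ 1, ∃ a b c : ℂ,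
      G = C a * X 0 + C b * X 1 + C c * X 2 := by
    intro G hG
    rw [homogeneousSubmodule_one_eq_span_X] at hG
    obtain ⟨c, rfl⟩ := (Submodule.mem_span_range_iff_exists_fun ℂ).mp hG
    exact ⟨c 0, c 1, c 2, by simp [Fin.sum_univ_three, smul_eq_C_mul]⟩
  induction hmem using Submodule.mul_induction_on' with
  | mem_mul_mem G hG H hH =>
    obtain ⟨a, b, c, rfl⟩ := hlin G hG
    obtain ⟨a', b', c', rfl⟩ := hlin H hH
    refine ⟨a * a', b * b', c * c', a * b' + b * a', b * c' + c * b', c * a' + a * c', ?_⟩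
    simp only [map_add, map_mul]
    ring
  | add G _ H _ hG hH =>
    obtain ⟨a, b, c, d, e, f, hG⟩ := hG
    obtain ⟨a', b', c', d', e', f', hH⟩ := hH
    refine ⟨a + a', b + b', c + c', d + d', e + e', f + f', ?_⟩
    rw [hG, hH]
    simp only [map_add]
    ring

/-- A contracted conic: for `ι = i` it passes through the points `[1 : -2i : 0]`, `[0 : 1 : ±2i]`
and `[±2i : 0 : 1]`. -/
def contractedConic {R : Type*} [CommRing R] (ι x y z : R) : R :=
  2 * x ^ 2 + 32 * y ^ 2 + 8 * z ^ 2 + 63 * ι * (x * y)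

/-- An equation of the conic through the base points other than the `i`-th one. -/
noncomputable def conicForm : Fin 6 → MvPolynomial (Fin 3) ℂ :=
  ![contractedConic (C Complex.I) (X 0) (X 1) (X 2),
    contractedConic (C (-Complex.I)) (X 0) (X 1) (X 2),
    contractedConic (C Complex.I) (X 1) (X 2) (X 0),
    contractedConic (C (-Complex.I)) (X 1) (X 2) (X 0),
    contractedConic (C Complex.I) (X 2) (X 0) (X 1),
    contractedConic (C (-Complex.I)) (X 2) (X 0) (X 1)]

theorem eval_contractedConic (c : ℂ) (i j k : Fin 3) (v : Fin 3 → ℂ) :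
    eval v (contractedConic (C c) (X i) (X j) (X k)) = contractedConic c (v i) (v j) (v k) := by
  simp [contractedConic, map_ofNat]

theorem VanishesAt.eval_basePoint {F : MvPolynomial (Fin 3) ℂ} {i : Fin 6}
    (h : VanishesAt F (basePoint i)) : eval (baseVec i) F = 0 :=
  h _ (by rw [basePoint, Projectivization.submodule_mk]; exact Submodule.mem_span_singleton_self _)
    (baseVec_ne_zero i)

/-- A conjugate pair of base points gives two equations differing in the sign of one mixed term, so
that term vanishes. This leaves b = 4c and c = 4a, and the equation of the one unpaired base point
fixes d. -/
theorem contractedConic_coeff {ι a b c d e f : ℂ} (hι : ι ^ 2 = -1) (h1 : a - 4 * b - 2 * ι * d = 0)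
    (h2 : b - 4 * c + 2 * Complex.I * e = 0) (h3 : b - 4 * c - 2 * Complex.I * e = 0)
    (h4 : c - 4 * a + 2 * Complex.I * f = 0) (h5 : c - 4 * a - 2 * Complex.I * f = 0) :
    b = 16 * a ∧ c = 4 * a ∧ d = 63 / 2 * ι * a ∧ e = 0 ∧ f = 0 := by
  have he : e = 0 := by
    have : Complex.I * e = 0 := by linear_combination (h2 - h3) / 4
    simpa using this
  have hf : f = 0 := by
    have : Complex.I * f = 0 := by linear_combination (h4 - h5) / 4
    simpa using this
  have hc : c = 4 * a := by linear_combination (h4 + h5) / 2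
  have hb : b = 16 * a := by linear_combination (h2 + h3) / 2 + 4 * hc
  refine ⟨hb, hc, ?_, he, hf⟩
  linear_combination ι / 2 * h1 + d * hι + 2 * ι * hb

/-- Five base points impose five independent linear conditions on six coefficients. Cyclic rotation
of the coordinates and the sign of ι reduce the six cases to `contractedConic_coeff`. This
uniqueness turns statements about any conic through five base points into statements about the
explicit ones. -/
theorem eq_C_mul_conicForm {F : MvPolynomial (Fin 3) ℂ} (hF : F.IsHomogeneous 2) (i : Fin 6)
    (h : ∀ j, j ≠ i → VanishesAt F (basePoint j)) : ∃ c : ℂ, F = C c * conicForm i := by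
  obtain ⟨a, b, c, d, e, f, rfl⟩ := exists_coeff_of_isHomogeneous_two hF
  have hI := Complex.I_sq
  have hI' : (-Complex.I) ^ 2 = -1 := by rw [neg_sq, Complex.I_sq]
  have key : ∀ j, j ≠ i → _ := fun j hj => (h j hj).eval_basePoint
  have e0 : (0 : Fin 6) ≠ i → a - 4 * b + 2 * Complex.I * d = 0 := fun hj => by
    have := key 0 hj
    simp [baseVec] at this
    linear_combination this - 4 * b * hI
  have e1 : (1 : Fin 6) ≠ i → a - 4 * b - 2 * Complex.I * d = 0 := fun hj => by
    have := key 1 hj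
    simp [baseVec] at this
    linear_combination this - 4 * b * hI
  have e2 : (2 : Fin 6) ≠ i → b - 4 * c + 2 * Complex.I * e = 0 := fun hj => by
    have := key 2 hj
    simp [baseVec] at this
    linear_combination this - 4 * c * hI
  have e3 : (3 : Fin 6) ≠ i → b - 4 * c - 2 * Complex.I * e = 0 := fun hj => by
    have := key 3 hj
    simp [baseVec] at this
    linear_combination this - 4 * c * hI
  have e4 : (4 : Fin 6) ≠ i → c - 4 * a + 2 * Complex.I * f = 0 := fun hj => by
    have := key 4 hj
    simp [baseVec] at this
    linear_combination this - 4 * a * hI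
  have e5 : (5 : Fin 6) ≠ i → c - 4 * a - 2 * Complex.I * f = 0 := fun hj => by
    have := key 5 hj
    simp [baseVec] at this
    linear_combination this - 4 * a * hI
  clear h key hF
  fin_cases i
  · obtain ⟨rfl, rfl, rfl, rfl, rfl⟩ := contractedConic_coeff hI (e1 (by decide)) (e2 (by decide))
      (e3 (by decide)) (e4 (by decide)) (e5 (by decide))
    refine ⟨a / 2, MvPolynomial.funext fun v => ?_⟩
    simp [conicForm, contractedConic, map_ofNat]
    ring
  · obtain ⟨rfl, rfl, rfl, rfl, rfl⟩ := contractedConic_coeff hI'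
      (show a - 4 * b - 2 * -Complex.I * d = 0 by linear_combination e0 (by decide))
      (e2 (by decide))
      (e3 (by decide)) (e4 (by decide)) (e5 (by decide))
    refine ⟨a / 2, MvPolynomial.funext fun v => ?_⟩
    simp [conicForm, contractedConic, map_ofNat]
    ring
  · obtain ⟨rfl, rfl, rfl, rfl, rfl⟩ := contractedConic_coeff hI (e3 (by decide)) (e4 (by decide))
      (e5 (by decide)) (e0 (by decide)) (e1 (by decide))
    refine ⟨b / 2, MvPolynomial.funext fun v => ?_⟩
    simp [conicForm, contractedConic, map_ofNat]
    ring
  · obtain ⟨rfl, rfl, rfl, rfl, rfl⟩ := contractedConic_coeff hI'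
      (show b - 4 * c - 2 * -Complex.I * e = 0 by linear_combination e2 (by decide))
      (e4 (by decide))
      (e5 (by decide)) (e0 (by decide)) (e1 (by decide))
    refine ⟨b / 2, MvPolynomial.funext fun v => ?_⟩
    simp [conicForm, contractedConic, map_ofNat]
    ring
  · obtain ⟨rfl, rfl, rfl, rfl, rfl⟩ := contractedConic_coeff hI (e5 (by decide)) (e0 (by decide))
      (e1 (by decide)) (e2 (by decide)) (e3 (by decide))
    refine ⟨c / 2, MvPolynomial.funext fun v => ?_⟩
    simp [conicForm, contractedConic, map_ofNat]
    ring
  · obtain ⟨rfl, rfl, rfl, rfl, rfl⟩ := contractedConic_coeff hI'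
      (show c - 4 * a - 2 * -Complex.I * f = 0 by linear_combination e4 (by decide))
      (e0 (by decide))
      (e1 (by decide)) (e2 (by decide)) (e3 (by decide))
    refine ⟨c / 2, MvPolynomial.funext fun v => ?_⟩
    simp [conicForm, contractedConic, map_ofNat]
    ring

/-! ### Nonsingularity of the conics and admissibility of the base points -/

theorem pderiv_ofNat {R σ : Type*} [CommSemiring R] (k : σ) (n : ℕ) [n.AtLeastTwo] :
    pderiv k (ofNat(n) : MvPolynomial σ R) = 0 := by
  rw [← map_ofNat C n, pderiv_C]

theorem isNonsingularCurve_contractedConic {c d : ℂ} (hc : c ≠ 0) (hd : d ^ 2 = -1)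
    (σ : Equiv.Perm (Fin 3)) :
    IsNonsingularCurve (C c * contractedConic (C d) (X (σ 0)) (X (σ 1)) (X (σ 2))) := by
  intro p _ h
  induction p using Projectivization.ind with
  | h v hv =>
    have hmem : v ∈ (Projectivization.mk ℂ v hv).submodule := by
      rw [Projectivization.submodule_mk]
      exact Submodule.mem_span_singleton_self v
    have e : ∀ k, eval v (pderiv (σ k)
        (C c * contractedConic (C d) (X (σ 0)) (X (σ 1)) (X (σ 2)))) = 0 :=
      fun k => h (σ k) v hmem hv
    have e0 : 4 * v (σ 0) + 63 * d * v (σ 1) = 0 := by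
      have := e 0
      simp [contractedConic, hc, pderiv_ofNat] at this
      linear_combination this
    have e1 : 64 * v (σ 1) + 63 * d * v (σ 0) = 0 := by
      have := e 1
      simp [contractedConic, hc, pderiv_ofNat] at this
      linear_combination this
    have k2 : v (σ 2) = 0 := by
      simpa [contractedConic, hc, pderiv_ofNat] using e 2
    -- The equations `e0` and `e1` form a 2 × 2 linear system of determinant 4·64 − 63²d² = 256 +
    -- 3969 = 4225.
    have k0 : v (σ 0) = 0 := by
      linear_combination (64 * e0 - 63 * d * e1 + 3969 * v (σ 0) * hd) / 4225
    have k1 : v (σ 1) = 0 := by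
      linear_combination (4 * e1 - 63 * d * e0 + 3969 * v (σ 1) * hd) / 4225
    apply hv
    ext i
    obtain ⟨j, rfl⟩ := σ.surjective i
    fin_cases j
    exacts [k0, k1, k2]

theorem isNonsingularCurve_conicForm {c : ℂ} (hc : c ≠ 0) (i : Fin 6) :
    IsNonsingularCurve (C c * conicForm i) := by
  have hI := Complex.I_sq
  have hI' : (-Complex.I) ^ 2 = -1 := by rw [neg_sq, Complex.I_sq]
  fin_cases i
  · exact isNonsingularCurve_contractedConic hc hI 1
  · exact isNonsingularCurve_contractedConic hc hI' 1
  · exact isNonsingularCurve_contractedConic hc hI (finRotate 3)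
  · exact isNonsingularCurve_contractedConic hc hI' (finRotate 3)
  · exact isNonsingularCurve_contractedConic hc hI (finRotate 3).symm
  · exact isNonsingularCurve_contractedConic hc hI' (finRotate 3).symm

theorem isAdmissibleSextuple_basePoint : IsAdmissibleSextuple basePoint where
  injective := basePoint_injective
  nonreal i h := by
    rw [conjPoint_basePoint] at h
    have := basePoint_injective h
    fin_cases i <;> simp at this
  conj_closed i := ⟨_, (conjPoint_basePoint i).symm⟩
  not_on_conic F hF h := by
    obtain ⟨c, rfl⟩ := eq_C_mul_conicForm hF.1 0 fun j _ => h j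
    have hc : c ≠ 0 := by
      rintro rfl
      exact hF.2 (by simp)
    have h0 := (h 0).eval_basePoint
    -- The conic through the other five base points takes the value 2 − 128 − 126 = −252 at the
    -- coordinate vector of the base point 0.
    have : c * 252 = 0 := by
      simp only [map_mul, eval_C, conicForm, Matrix.cons_val, eval_contractedConic] at h0
      simp only [contractedConic, baseVec, Matrix.cons_val] at h0
      linear_combination -h0 + 254 * c * Complex.I_sq
    exact hc (by simpa using this)
  nonsingular i F hF h := by
    obtain ⟨c, rfl⟩ := eq_C_mul_conicForm hF.1 i h
    refine isNonsingularCurve_conicForm ?_ i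
    rintro rfl
    exact hF.2 (by simp)

/-! ### The quintic map is a quintic Cremona transformation -/

theorem quinticMap_complexForm (k : Fin 3) : quinticMap.complexForm k = quinticVec X k := by
  change map (algebraMap ℝ ℂ) (quinticVec X k) = _
  simp [map_quinticVec]

/-- The pointwise form of the elimination in `isUnit_of_dvd_quinticVec`: two of the three quadrics
vanish, which forces a coordinate to vanish. -/
theorem conicPair_ne_zero_of_ne_zero {x y z : ℂ} (hx : x ≠ 0) (hy : y ≠ 0) (hz : z ≠ 0)
    (h0 : conicPair x y z = 0) (h1 : conicPair y z x = 0) (h2 : conicPair z x y = 0) : False := by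
  have hlin : ∀ {x y z : ℂ}, conicPair x y z = 0 → conicPair y z x = 0 →
      4 * x ^ 2 + y ^ 2 + 16 * z ^ 2 = 0 ∨ 4 * y ^ 2 + z ^ 2 + 16 * x ^ 2 = 0 := by
    intro x y z h1 h2
    have := conicPair_add x y z
    rw [h1, h2] at this
    simpa using this.symm
  have hfin : ∀ {x y z : ℂ}, z ≠ 0 → 4 * x ^ 2 + y ^ 2 + 16 * z ^ 2 = 0 →
      4 * y ^ 2 + z ^ 2 + 16 * x ^ 2 ≠ 0 := by
    intro x y z hz h1 h2
    have : z ^ 2 = 0 := by linear_combination (4 * h1 - h2) / 63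
    exact hz (by simpa using this)
  rcases hlin h0 h1 with h | h
  · exact (hlin h1 h2).elim (hfin hz h) fun h' => hfin hy h' h
  · exact (hlin h2 h0).elim (hfin hx h) fun h' => hfin hz h' h

theorem four_mul_sq_add_sq {y z : ℂ} (h : 4 * y ^ 2 + z ^ 2 = 0) :
    z = 2 * Complex.I * y ∨ z = -(2 * Complex.I) * y := by
  have : (z - 2 * Complex.I * y) * (z + 2 * Complex.I * y) = 0 := by
    linear_combination h - 4 * y ^ 2 * Complex.I_sq
  rcases mul_eq_zero.mp this with h | h
  · exact Or.inl (by linear_combination h)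
  · exact Or.inr (by linear_combination h)

/-- On a coordinate line both surviving quartics are multiples of the square of 4y² + z², whose
zeros are the two base points on that line. -/
theorem four_mul_sq_add_sq_of_quintic {y z : ℂ} (h1 : y * conicPair y z 0 = 0)
    (h2 : z * conicPair z 0 y = 0) : 4 * y ^ 2 + z ^ 2 = 0 := by
  have e1 : y * conicPair y z 0 = 4 * y * (4 * y ^ 2 + z ^ 2) ^ 2 := by
    simp only [conicPair]
    ring
  have e2 : z * conicPair z 0 y = 64 * z * (4 * y ^ 2 + z ^ 2) ^ 2 := by
    simp only [conicPair]
    ring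
  rw [e1] at h1
  rw [e2] at h2
  simp only [mul_eq_zero, OfNat.ofNat_ne_zero, false_or, pow_eq_zero_iff, ne_eq,
    not_false_eq_true] at h1 h2
  rcases h1 with h1 | h1
  · rcases h2 with h2 | h2
    · simp [h1, h2]
    · exact h2
  · exact h1

theorem quinticVec_eq_zero {v : Fin 3 → ℂ} (h : ∀ k, quinticVec v k = 0) :
    ∃ (i : Fin 6) (c : ℂ), c • baseVec i = v := by
  have h0 : v 0 * conicPair (v 0) (v 1) (v 2) = 0 := h 0
  have h1 : v 1 * conicPair (v 1) (v 2) (v 0) = 0 := h 1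
  have h2 : v 2 * conicPair (v 2) (v 0) (v 1) = 0 := h 2
  by_cases x0 : v 0 = 0
  · rw [x0] at h1 h2
    rcases four_mul_sq_add_sq (four_mul_sq_add_sq_of_quintic h1 h2) with e | e
    · refine ⟨2, v 1, ?_⟩
      ext j
      fin_cases j <;> simp [baseVec, x0, e, mul_comm]
    · refine ⟨3, v 1, ?_⟩
      ext j
      fin_cases j <;> simp [baseVec, x0, e, mul_comm]
  by_cases x1 : v 1 = 0
  · rw [x1] at h0 h2
    rcases four_mul_sq_add_sq (four_mul_sq_add_sq_of_quintic h2 h0) with e | e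
    · refine ⟨4, v 2, ?_⟩
      ext j
      fin_cases j <;> simp [baseVec, x1, e, mul_comm]
    · refine ⟨5, v 2, ?_⟩
      ext j
      fin_cases j <;> simp [baseVec, x1, e, mul_comm]
  by_cases x2 : v 2 = 0
  · rw [x2] at h0 h1
    rcases four_mul_sq_add_sq (four_mul_sq_add_sq_of_quintic h0 h1) with e | e
    · refine ⟨0, v 0, ?_⟩
      ext j
      fin_cases j <;> simp [baseVec, x2, e, mul_comm]
    · refine ⟨1, v 0, ?_⟩
      ext j
      fin_cases j <;> simp [baseVec, x2, e, mul_comm]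
  exact (conicPair_ne_zero_of_ne_zero x0 x1 x2 (by simpa [x0] using h0) (by simpa [x1] using h1)
    (by simpa [x2] using h2)).elim

theorem eval_quinticVec_baseVec (i : Fin 6) (k : Fin 3) :
    eval (baseVec i) (quinticVec X k) = 0 := by
  have hI := Complex.I_sq
  have hI4 : Complex.I ^ 4 = 1 := Complex.I_pow_four
  rw [eval_quinticVec_X]
  fin_cases i <;> fin_cases k <;> simp [baseVec, quinticVec, conicPair, mul_pow] <;>
    norm_num [hI, hI4]

/-- The product rule leaves only xᵢ times a derivative of the quartic. Either xᵢ = 0, or the quartic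
4L² + 63²(xⱼxₖ)² is singular at the point because L and xⱼxₖ both vanish there. -/
theorem pderiv_mul_conicPair_eq_zero (v : Fin 3 → ℂ) (i j k l : Fin 3)
    (hp : conicPair (v i) (v j) (v k) = 0)
    (hv : v i = 0 ∨ 4 * v i ^ 2 + v j ^ 2 + 16 * v k ^ 2 = 0 ∧ v j * v k = 0) :
    eval v (pderiv l (X i * conicPair (X i) (X j) (X k))) = 0 := by
  have he : eval v (conicPair (X i) (X j) (X k)) = conicPair (v i) (v j) (v k) := by
    simp [conicPair, map_ofNat]
  rw [pderiv_mul, map_add, map_mul, map_mul, he, hp, mul_zero, zero_add, eval_X]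
  rcases hv with hv | ⟨hL, hjk⟩
  · rw [hv, zero_mul]
  · have e : (conicPair (X i) (X j) (X k) : MvPolynomial (Fin 3) ℂ) =
        C 4 * (4 * X i ^ 2 + X j ^ 2 + 16 * X k ^ 2) ^ 2 + C 3969 * (X j * X k) ^ 2 := by
      rw [map_ofNat C 4, map_ofNat C 3969, conicPair, mul_pow]
    have hL' : eval v (4 * X i ^ 2 + X j ^ 2 + 16 * X k ^ 2) = 0 := by
      simpa [map_ofNat] using hL
    have hjk' : eval v (X j * X k) = 0 := by simpa using hjk
    rw [e, map_add, pderiv_C_mul, pderiv_C_mul, pderiv_pow, pderiv_pow]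
    simp only [map_add, map_mul, map_pow, hL', hjk']
    simp

theorem pderiv_quinticVec_baseVec (i : Fin 6) (k l : Fin 3) :
    eval (baseVec i) (pderiv l (quinticVec X k)) = 0 := by
  have hI := Complex.I_sq
  have hI4 : Complex.I ^ 4 = 1 := Complex.I_pow_four
  fin_cases k
  · refine pderiv_mul_conicPair_eq_zero _ 0 1 2 l ?_ ?_ <;> fin_cases i <;>
      simp [baseVec, conicPair, mul_pow] <;> norm_num [hI, hI4]
  · refine pderiv_mul_conicPair_eq_zero _ 1 2 0 l ?_ ?_ <;> fin_cases i <;>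
      simp [baseVec, conicPair, mul_pow] <;> norm_num [hI, hI4]
  · refine pderiv_mul_conicPair_eq_zero _ 2 0 1 l ?_ ?_ <;> fin_cases i <;>
      simp [baseVec, conicPair, mul_pow] <;> norm_num [hI, hI4]

/-- The conic is a factor of the third quartic, so the last coordinate of the image vanishes. On the
conic the other two coordinates both become constant multiples of x²y²(y + 2ιx), with ratio 2 : ι;
hence the image point is [2 : ι : 0]. -/
theorem quinticVec_of_contractedConic {ι x y z : ℂ} (hι : ι ^ 2 = -1)
    (h : contractedConic ι x y z = 0) :
    2 * (y * conicPair y z x) = ι * (x * conicPair x y z) ∧ z * conicPair z x y = 0 := by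
  unfold contractedConic at h
  have s1 : 4 * x ^ 2 + y ^ 2 + 16 * z ^ 2 = -63 * (y * (y + 2 * ι * x)) := by
    linear_combination 2 * h
  have s2 : 4 * (y + 2 * ι * x) ^ 2 + z ^ 2 = 65 / 8 * (x * (ι * y - 2 * x)) := by
    linear_combination h / 8 + 16 * x ^ 2 * hι
  have s3 : 4 * y ^ 2 + z ^ 2 + 16 * x ^ 2 = 63 / 8 * (x * (2 * x - ι * y)) := by
    linear_combination h / 8
  have s4 : (2 * x - ι * y) ^ 2 / 16 + z ^ 2 = -(65 / 16) * (y * (y + 2 * ι * x)) := by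
    linear_combination h / 8 + y ^ 2 / 16 * hι
  have q1 : conicPair x y z = 63 ^ 2 * (65 / 8) * (y ^ 2 * (x * (ι * y - 2 * x))) := by
    rw [conicPair, s1]
    linear_combination 3969 * y ^ 2 * s2
  have q2 : conicPair y z x = -(63 ^ 2 * (65 / 16)) * (x ^ 2 * (y * (y + 2 * ι * x))) := by
    rw [conicPair, s3]
    linear_combination 3969 * x ^ 2 * s4
  refine ⟨?_, ?_⟩
  · rw [q1, q2]
    linear_combination -(63 ^ 2 * (65 / 8)) * x ^ 2 * y ^ 3 * hι
  · have s5 : 4 * z ^ 2 + x ^ 2 + 16 * y ^ 2 = -(63 / 2) * ι * (x * y) := by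
      linear_combination h / 2
    rw [conicPair, s5]
    linear_combination 3969 * z * x ^ 2 * y ^ 2 * hι

/-- Coordinate vectors of the points to which the six conics are contracted. -/
noncomputable def contractedVec : Fin 6 → Fin 3 → ℂ :=
  ![![2, Complex.I, 0], ![2, -Complex.I, 0], ![0, 2, Complex.I], ![0, 2, -Complex.I],
    ![Complex.I, 0, 2], ![-Complex.I, 0, 2]]

theorem contractedVec_ne_zero (i : Fin 6) : contractedVec i ≠ 0 := by
  intro h
  fin_cases i
  · simpa [contractedVec] using congrFun h 0
  · simpa [contractedVec] using congrFun h 0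
  · simpa [contractedVec] using congrFun h 1
  · simpa [contractedVec] using congrFun h 1
  · simpa [contractedVec] using congrFun h 2
  · simpa [contractedVec] using congrFun h 2

/-- The points to which the six conics are contracted. -/
noncomputable def contractedPoint (i : Fin 6) : ComplexPlane :=
  Projectivization.mk ℂ (contractedVec i) (contractedVec_ne_zero i)

theorem contractedPoint_injective : Function.Injective contractedPoint := by
  have hI : Complex.I ≠ -Complex.I := by
    intro h
    exact two_mul_I_ne (by linear_combination 2 * h)
  have hI' := hI.symm
  have hI0 := Complex.I_ne_zero.symm
  intro i j h
  obtain ⟨c, hc⟩ := (Projectivization.mk_eq_mk_iff' ℂ _ _ _ _).mp h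
  have h0 := congrFun hc 0
  have h1 := congrFun hc 1
  have h2 := congrFun hc 2
  clear h hc
  fin_cases i <;> fin_cases j <;> simp [contractedVec] at h0 h1 h2 ⊢ <;> simp_all

theorem quinticVec_of_conicForm {i : Fin 6} {v : Fin 3 → ℂ} (h : eval v (conicForm i) = 0) :
    ∃ c : ℂ, c • contractedVec i = quinticVec v := by
  have hI := Complex.I_sq
  have hI' : (-Complex.I) ^ 2 = -1 := by rw [neg_sq, Complex.I_sq]
  fin_cases i <;>
    simp only [conicForm, Matrix.cons_val, Fin.zero_eta, Fin.mk_one, Fin.reduceFinMk,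
      eval_contractedConic] at h
  · obtain ⟨e1, e2⟩ := quinticVec_of_contractedConic hI h
    refine ⟨v 0 * conicPair (v 0) (v 1) (v 2) / 2, ?_⟩
    ext j
    fin_cases j <;> simp [contractedVec, quinticVec]
    · linear_combination -e1 / 2
    · simpa using e2
  · obtain ⟨e1, e2⟩ := quinticVec_of_contractedConic hI' h
    refine ⟨v 0 * conicPair (v 0) (v 1) (v 2) / 2, ?_⟩
    ext j
    fin_cases j <;> simp [contractedVec, quinticVec]
    · linear_combination -e1 / 2
    · simpa using e2
  · obtain ⟨e1, e2⟩ := quinticVec_of_contractedConic hI h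
    refine ⟨v 1 * conicPair (v 1) (v 2) (v 0) / 2, ?_⟩
    ext j
    fin_cases j <;> simp [contractedVec, quinticVec]
    · simpa using e2
    · linear_combination -e1 / 2
  · obtain ⟨e1, e2⟩ := quinticVec_of_contractedConic hI' h
    refine ⟨v 1 * conicPair (v 1) (v 2) (v 0) / 2, ?_⟩
    ext j
    fin_cases j <;> simp [contractedVec, quinticVec]
    · simpa using e2
    · linear_combination -e1 / 2
  · obtain ⟨e1, e2⟩ := quinticVec_of_contractedConic hI h
    refine ⟨v 2 * conicPair (v 2) (v 0) (v 1) / 2, ?_⟩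
    ext j
    fin_cases j <;> simp [contractedVec, quinticVec]
    · linear_combination -e1 / 2
    · simpa using e2
  · obtain ⟨e1, e2⟩ := quinticVec_of_contractedConic hI' h
    refine ⟨v 2 * conicPair (v 2) (v 0) (v 1) / 2, ?_⟩
    ext j
    fin_cases j <;> simp [contractedVec, quinticVec]
    · linear_combination -e1 / 2
    · simpa using e2

theorem isQuinticCremona_quinticMap : IsQuinticCremona basePoint quinticMap where
  birational := ⟨quinticInverse, quinticMap_areInverse⟩
  quintic := rfl
  admissible := isAdmissibleSextuple_basePoint
  base_points p := by
    induction p using Projectivization.ind with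
    | h v hv =>
      simp only [quinticMap_complexForm, vanishesAt_mk (quinticVec_X_isHomogeneous _),
        eval_quinticVec_X]
      refine ⟨fun h => ?_, ?_⟩
      · obtain ⟨i, c, hc⟩ := quinticVec_eq_zero h
        exact ⟨i, (Projectivization.mk_eq_mk_iff' ℂ _ _ _ _).mpr ⟨c, hc⟩⟩
      · rintro ⟨i, hi⟩ k
        obtain ⟨c, rfl⟩ := (Projectivization.mk_eq_mk_iff' ℂ _ _ _ _).mp hi
        rw [← eval_quinticVec_X, (quinticVec_X_isHomogeneous k).eval_smul_vector,
          eval_quinticVec_baseVec, mul_zero]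
  double i k l := by
    rw [quinticMap_complexForm, basePoint, vanishesAt_mk (quinticVec_X_isHomogeneous k).pderiv]
    exact pderiv_quinticVec_baseVec i k l
  contracts := by
    refine ⟨contractedPoint, contractedPoint_injective, fun i F hF h v hv hw => ?_⟩
    obtain ⟨c, rfl⟩ := eq_C_mul_conicForm hF.1 i h
    have hc : c ≠ 0 := by
      rintro rfl
      exact hF.2 (by simp)
    obtain ⟨d, hd⟩ := quinticVec_of_conicForm (by simpa [hc] using hv)
    refine (Projectivization.mk_eq_mk_iff' ℂ _ _ _ _).mpr ⟨d, hd.trans ?_⟩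
    ext k
    rw [quinticMap_complexForm, eval_quinticVec_X]

/-! ### General position after a projective transformation -/

theorem OnLineThrough.det_eq_zero {a b c : Fin 3 → ℝ} {ha : a ≠ 0} {hb : b ≠ 0} {hc : c ≠ 0}
    (h : OnLineThrough (Projectivization.mk ℝ a ha) (Projectivization.mk ℝ b hb)
      (Projectivization.mk ℝ c hc)) : Matrix.det (Matrix.of ![a, b, c]) = 0 := by
  rw [OnLineThrough, Projectivization.submodule_mk, Projectivization.submodule_mk,
    Projectivization.submodule_mk, Submodule.span_singleton_le_iff_mem, Submodule.mem_sup] at h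
  obtain ⟨y, hy, z, hz, rfl⟩ := h
  obtain ⟨s, rfl⟩ := Submodule.mem_span_singleton.mp hy
  obtain ⟨t, rfl⟩ := Submodule.mem_span_singleton.mp hz
  simp only [Matrix.det_fin_three, Matrix.of_apply, Matrix.cons_val, Pi.add_apply, Pi.smul_apply,
    smul_eq_mul]
  ring

/-- The vectors are the rows of `v` and `w`. The targets are arbitrary, so A may be singular. -/
theorem exists_matrix_mulVec_eq {v : Matrix (Fin 3) (Fin 3) ℝ} (hv : v.det ≠ 0)
    (w : Matrix (Fin 3) (Fin 3) ℝ) :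
    ∃ A : Matrix (Fin 3) (Fin 3) ℝ, ∀ k, A.mulVec (v k) = w k := by
  refine ⟨w.transpose * v.transpose⁻¹, fun k => ?_⟩
  have h : w.transpose * v.transpose⁻¹ * v.transpose = w.transpose := by
    rw [Matrix.mul_assoc, Matrix.nonsing_inv_mul, Matrix.mul_one]
    rw [Matrix.det_transpose]
    exact hv.isUnit
  ext i
  exact congrFun (congrFun h i) k

theorem quinticVec_smul (c : ℝ) (v : Fin 3 → ℝ) : quinticVec (c • v) = c ^ 5 • quinticVec v := by
  ext i
  fin_cases i <;> simp [quinticVec, conicPair] <;> ring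

/-- A need not be invertible, since only the nonvanishing of a polynomial in its entries is at
stake. A noncollinear triple is sent to the coordinate points, which the quintic map fixes. A
collinear one is sent to [1:0:0], [0:1:1], [1:1:1], whose images are not collinear. -/
theorem exists_matrix_det_quinticVec_ne_zero {p q r : RealPlane} (hpq : p ≠ q) (hpr : p ≠ r)
    (hqr : q ≠ r) : ∃ A : Matrix (Fin 3) (Fin 3) ℝ,
      Matrix.det (Matrix.of ![quinticVec (A.mulVec p.rep), quinticVec (A.mulVec q.rep),
        quinticVec (A.mulVec r.rep)]) ≠ 0 := by
  rw [← Projectivization.linearIndependent_pair_iff_ne] at hpq hpr hqr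
  by_cases hdet : Matrix.det (Matrix.of ![p.rep, q.rep, r.rep]) = 0
  · obtain ⟨c, hc, hcv⟩ := Matrix.exists_vecMul_eq_zero_iff.mpr hdet
    have hrel : c 0 • p.rep + c 1 • q.rep + c 2 • r.rep = 0 := by
      ext i
      simpa [Matrix.vecMul, dotProduct, Fin.sum_univ_three] using congrFun hcv i
    rw [LinearIndependent.pair_iff] at hpr hqr
    have hall : c 0 = 0 ∧ c 1 = 0 ∧ c 2 = 0 → False := by
      rintro ⟨h0, h1, h2⟩
      apply hc
      ext i
      fin_cases i
      exacts [h0, h1, h2]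
    -- All three coefficients of the linear relation are nonzero, since the points are pairwise
    -- distinct.
    have c0 : c 0 ≠ 0 := by
      intro h0
      rw [h0, zero_smul, zero_add] at hrel
      exact hall ⟨h0, hqr _ _ hrel⟩
    have c1 : c 1 ≠ 0 := by
      intro h1
      rw [h1, zero_smul, add_zero] at hrel
      exact hall ⟨(hpr _ _ hrel).1, h1, (hpr _ _ hrel).2⟩
    have c2 : c 2 ≠ 0 := by
      intro h2
      rw [h2, zero_smul, add_zero] at hrel
      have := LinearIndependent.pair_iff.mp hpq _ _ hrel
      exact hall ⟨this.1, this.2, h2⟩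
    -- The cross product completes p and q to a basis; the determinant is its squared length.
    have hcross : Matrix.det ![crossProduct p.rep q.rep, p.rep, q.rep] ≠ 0 := by
      rw [← triple_product_eq_det]
      exact fun h => (crossProduct_ne_zero_iff_linearIndependent.mpr hpq)
        (dotProduct_self_eq_zero.mp h)
    -- Scaling by the inverse coefficients makes the linear relation give −(c 2)⁻¹ (1,1,1) as the
    -- image of r.
    obtain ⟨A, hA⟩ := exists_matrix_mulVec_eq hcross
      ![0, (c 0)⁻¹ • ![1, 0, 0], (c 1)⁻¹ • ![0, 1, 1]]
    have hAp : A.mulVec p.rep = (c 0)⁻¹ • ![1, 0, 0] := hA 1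
    have hAq : A.mulVec q.rep = (c 1)⁻¹ • ![0, 1, 1] := hA 2
    have hAr : A.mulVec r.rep = (-(c 2)⁻¹) • ![1, 1, 1] := by
      have h := congrArg A.mulVec hrel
      rw [Matrix.mulVec_add, Matrix.mulVec_add, Matrix.mulVec_smul, Matrix.mulVec_smul,
        Matrix.mulVec_smul, Matrix.mulVec_zero, hAp, hAq, smul_smul, smul_smul,
        mul_inv_cancel₀ c0, mul_inv_cancel₀ c1] at h
      ext i
      have hi := congrFun h i
      simp only [Pi.add_apply, Pi.smul_apply, smul_eq_mul, Pi.zero_apply] at hi ⊢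
      field_simp
      fin_cases i <;> simp at hi ⊢ <;> linear_combination hi
    refine ⟨A, ?_⟩
    rw [hAp, hAq, hAr, quinticVec_smul, quinticVec_smul, quinticVec_smul, Matrix.det_fin_three]
    simp only [Matrix.of_apply, Matrix.cons_val, Pi.smul_apply, smul_eq_mul, quinticVec, conicPair]
    intro h
    -- The quintic map sends (1,0,0), (0,1,1), (1,1,1) to (64,0,0), (0,100,1600), 5733·(1,1,1). The
    -- determinant is thus, up to sign, 64·5733·(1600 − 100), times the fifth powers of the scalars.
    have h5 : ((c 0)⁻¹ * (c 1)⁻¹ * (c 2)⁻¹) ^ 5 = 0 := by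
      linear_combination h / (64 * 5733 * 1500)
    simp [c0, c1, c2] at h5
  · obtain ⟨A, hA⟩ := exists_matrix_mulVec_eq hdet ![![1, 0, 0], ![0, 1, 0], ![0, 0, 1]]
    have h0 : A.mulVec p.rep = ![1, 0, 0] := hA 0
    have h1 : A.mulVec q.rep = ![0, 1, 0] := hA 1
    have h2 : A.mulVec r.rep = ![0, 0, 1] := hA 2
    refine ⟨A, ?_⟩
    rw [h0, h1, h2, Matrix.det_fin_three]
    simp [quinticVec, conicPair]

/-- The determinant of the images of three vectors under the composition of the quintic map with
a linear map, as a polynomial in the matrix entries of the linear map. -/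
noncomputable def quinticDet (u v w : Fin 3 → ℝ) : MvPolynomial (Fin 3 × Fin 3) ℝ :=
  Matrix.det (Matrix.of ![
    quinticVec ((Matrix.mvPolynomialX (Fin 3) (Fin 3) ℝ).mulVec fun i => C (u i)),
    quinticVec ((Matrix.mvPolynomialX (Fin 3) (Fin 3) ℝ).mulVec fun i => C (v i)),
    quinticVec ((Matrix.mvPolynomialX (Fin 3) (Fin 3) ℝ).mulVec fun i => C (w i))])

theorem eval_quinticDet (u v w : Fin 3 → ℝ) (A : Matrix (Fin 3) (Fin 3) ℝ) :
    eval (fun ij => A ij.1 ij.2) (quinticDet u v w) =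
      Matrix.det (Matrix.of ![quinticVec (A.mulVec u), quinticVec (A.mulVec v),
        quinticVec (A.mulVec w)]) := by
  have h : ∀ (x : Fin 3 → ℝ) (j : Fin 3), eval (fun ij => A ij.1 ij.2)
      (quinticVec ((Matrix.mvPolynomialX (Fin 3) (Fin 3) ℝ).mulVec fun i => C (x i)) j) =
      quinticVec (A.mulVec x) j := by
    intro x j
    rw [map_quinticVec]
    congr 1
    ext i
    simp [Matrix.mulVec, dotProduct]
  rw [quinticDet, RingHom.map_det]
  congr 1
  ext i j
  fin_cases i <;> exact h _ j

/-- Finitely many nonzero polynomials in the matrix entries have a common real nonzero. Including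
det among them makes A invertible, although the witnesses for the single factors may be singular. -/
theorem exists_GL_det_quinticVec_ne_zero {ι : Type*} [Fintype ι] {p q : RealPlane} (hpq : p ≠ q)
    (r : ι → RealPlane) (hr : ∀ i, p ≠ r i ∧ q ≠ r i) : ∃ A : GL (Fin 3) ℝ, ∀ i,
      Matrix.det (Matrix.of ![quinticVec (A.val.mulVec p.rep), quinticVec (A.val.mulVec q.rep),
        quinticVec (A.val.mulVec (r i).rep)]) ≠ 0 := by
  have hne : Matrix.det (Matrix.mvPolynomialX (Fin 3) (Fin 3) ℝ) *
      ∏ i, quinticDet p.rep q.rep (r i).rep ≠ 0 := by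
    refine mul_ne_zero (Matrix.det_mvPolynomialX_ne_zero _ _) (Finset.prod_ne_zero_iff.mpr ?_)
    intro i _ h0
    obtain ⟨A, hA⟩ := exists_matrix_det_quinticVec_ne_zero hpq (hr i).1 (hr i).2
    apply hA
    rw [← eval_quinticDet, h0, map_zero]
  obtain ⟨A, hA⟩ : ∃ A : Matrix (Fin 3) (Fin 3) ℝ, eval (fun ij => A ij.1 ij.2)
      (Matrix.det (Matrix.mvPolynomialX (Fin 3) (Fin 3) ℝ) *
        ∏ i, quinticDet p.rep q.rep (r i).rep) ≠ 0 := by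
    by_contra! h
    refine hne (MvPolynomial.funext fun a => ?_)
    rw [map_zero]
    exact h (Matrix.of fun i j => a (i, j))
  rw [map_mul, map_prod] at hA
  have hdet : A.det ≠ 0 := by
    have h := left_ne_zero_of_mul hA
    rwa [RingHom.map_det, Matrix.mvPolynomialX_mapMatrix_eval] at h
  have hprod := right_ne_zero_of_mul hA
  refine ⟨Matrix.GeneralLinearGroup.mkOfDetNeZero A hdet, fun i => ?_⟩
  have h := Finset.prod_ne_zero_iff.mp hprod i (Finset.mem_univ i)
  rw [eval_quinticDet] at h
  exact h

/-! ### The main theorem -/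

theorem mainTheorem6 (n : ℕ) (hn : 2 ≤ n) (P : Fin n → RealPlane) (hP : Function.Injective P) :
    ∃ (f : RationalSelfMap) (φ : RealPlane → RealPlane),
      f.IsBirational ∧
      f.RestrictsTo φ ∧
      IsAlgebraicDiffeomorphism φ ∧
      (∀ i : Fin n, 2 ≤ i.val →
        ¬ OnLineThrough (φ (P ⟨0, by omega⟩)) (φ (P ⟨1, by omega⟩)) (φ (P i))) ∧
      ∃ (Q : Fin 6 → ComplexPlane) (g : RationalSelfMap) (A : GL (Fin 3) ℝ),
        IsQuinticCremona Q g ∧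
        SameRationalMap f.form (compForms g.form (linearForms A.val)) := by
  have hne : ∀ i j : Fin n, i.val ≠ j.val → P i ≠ P j := fun i j hij h =>
    hij (congrArg Fin.val (hP h))
  obtain ⟨A, hA⟩ := exists_GL_det_quinticVec_ne_zero (ι := {i : Fin n // 2 ≤ i.val})
    (hne ⟨0, by omega⟩ ⟨1, by omega⟩ (by simp)) (fun i => P i.val) fun i =>
      ⟨hne _ _ (by have := i.2; simp only; omega), hne _ _ (by have := i.2; simp only; omega)⟩
  have hinv := quinticMap_areInverse.precomp A
  have hreg := quinticMap_isRegular.precomp A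
  refine ⟨quinticMap.precomp A, (quinticMap.precomp A).realMap hreg, ⟨_, hinv⟩,
    RationalSelfMap.restrictsTo_realMap _ hreg,
    hinv.isAlgebraicDiffeomorphism hreg (quinticInverse_isRegular.postcomp _), fun i hi h => ?_,
    basePoint, quinticMap, A, isQuinticCremona_quinticMap, fun i j => mul_comm _ _⟩
  have heval : ∀ v, evalForms (quinticMap.precomp A).form v = quinticVec (A.val.mulVec v) := by
    intro v
    rw [← evalForms_linearForms, ← evalForms_quinticMap, ← evalForms_compForms]
    rfl
  have := h.det_eq_zero
  rw [heval, heval, heval] at this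
  exact hA ⟨i, hi⟩ this
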